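/- Let $\mathscr{E}$ be an elementary topos, that is, a category with finite limits that is cartesian closed and has a subobject classifier. Then the opposite category $\mathscr{E}^{\mathrm{op}}$ (a cotopos) is ideally exact. Here a category $\mathscr{A}$ is called \emph{ideally exact} if it is Barr exact and Bourn protomodular, it has finite coproducts, and the unique morphism $0\to 1$ from its initial object to its terminal object is a regular epimorphism. \emph{Barr exact} means: $\mathscr{A}$ has finite limits, every kernel pair has a coequalizer, regular epimorphisms are stable under pullback, and every internal equivalence relation is effective, i.e. is the kernel pair of its coequalizer. \emph{Bourn protomodular} means: $\mathscr{A}$ has pullbacks and, for every morphism $v:E\to B$ of $\mathscr{A}$, the pullback functor $v^*:\mathrm{Pt}(B)\to\mathrm{Pt}(E)$ reflects isomorphisms, where $\mathrm{Pt}(B)$ is the category of split epimorphisms $p:X\to B$ with a chosen section $s$, its morphisms being the morphisms of domains that commute with the split epimorphisms and with the sections. -/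

import Mathlib

open CategoryTheory CategoryTheory.Limits

universe v u

namespace IdeallyExact

/-- A point over `B`: a split epimorphism `p : X ⟶ B` together with a chosen section `s`. -/
structure Pt {C : Type u} [Category.{v} C] (B : C) where
  /-- the domain of the split epimorphism -/
  X : C
  /-- the split epimorphism -/
  p : X ⟶ B
  /-- the chosen section -/
  s : B ⟶ X
  w : s ≫ p = 𝟙 B

/-- A morphism of points over `B`: a morphism of the domains that commutes with the split
epimorphisms and with the sections. -/
@[ext]
structure PtHom {C : Type u} [Category.{v} C] {B : C} (P Q : Pt B) where
  /-- the underlying morphism -/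
  hom : P.X ⟶ Q.X
  comm_p : hom ≫ Q.p = P.p
  comm_s : P.s ≫ hom = Q.s

/-- The category `Pt(B)` of points over `B`. -/
instance Pt.category {C : Type u} [Category.{v} C] (B : C) : Category (Pt B) where
  Hom P Q := PtHom P Q
  id P := ⟨𝟙 P.X, Category.id_comp _, Category.comp_id _⟩
  comp f g := ⟨f.hom ≫ g.hom, by rw [Category.assoc, g.comm_p, f.comm_p],
    by rw [← Category.assoc, f.comm_s, g.comm_s]⟩
  id_comp f := PtHom.ext (Category.id_comp f.hom)
  comp_id f := PtHom.ext (Category.comp_id f.hom)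
  assoc f g h := PtHom.ext (Category.assoc f.hom g.hom h.hom)

/-- The section induced on the pullback of a point over `B` along `v : E ⟶ B`. -/
noncomputable def Pt.pullbackSection {C : Type u} [Category.{v} C] [HasPullbacks C] {E B : C}
    (v : E ⟶ B) (P : Pt B) : E ⟶ pullback P.p v :=
  pullback.lift (v ≫ P.s) (𝟙 E) (by simp [P.w])

/-- The morphism induced between the pullbacks along `v : E ⟶ B` of two points over `B`. -/
noncomputable def Pt.pullbackMap {C : Type u} [Category.{v} C] [HasPullbacks C] {E B : C}
    (v : E ⟶ B) {P Q : Pt B} (f : PtHom P Q) : pullback P.p v ⟶ pullback Q.p v :=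
  pullback.lift (pullback.fst P.p v ≫ f.hom) (pullback.snd P.p v)
    (by simp [f.comm_p, pullback.condition])

theorem Pt.pullbackSection_comp_map {C : Type u} [Category.{v} C] [HasPullbacks C] {E B : C}
    (v : E ⟶ B) {P Q : Pt B} (f : PtHom P Q) :
    Pt.pullbackSection v P ≫ Pt.pullbackMap v f = Pt.pullbackSection v Q := by
  apply pullback.hom_ext <;>
    simp [Pt.pullbackSection, Pt.pullbackMap, f.comm_s, pullback.lift_fst, pullback.lift_snd,
      pullback.lift_fst_assoc]

theorem Pt.pullbackMap_id {C : Type u} [Category.{v} C] [HasPullbacks C] {E B : C}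
    (v : E ⟶ B) (P : Pt B) : Pt.pullbackMap v (𝟙 P : P ⟶ P) = 𝟙 (pullback P.p v) := by
  have h : PtHom.hom (𝟙 P : P ⟶ P) = 𝟙 P.X := rfl
  apply pullback.hom_ext <;>
    simp [Pt.pullbackMap, h]

theorem Pt.pullbackMap_comp {C : Type u} [Category.{v} C] [HasPullbacks C] {E B : C}
    (v : E ⟶ B) {P Q R : Pt B} (f : P ⟶ Q) (g : Q ⟶ R) :
    Pt.pullbackMap v (f ≫ g) = Pt.pullbackMap v f ≫ Pt.pullbackMap v g := by
  have h : PtHom.hom (f ≫ g) = PtHom.hom f ≫ PtHom.hom g := rfl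
  apply pullback.hom_ext <;>
    simp [Pt.pullbackMap, h, pullback.lift_fst, pullback.lift_snd, pullback.lift_fst_assoc]

/-- The change-of-base functor `v^* : Pt(B) ⥤ Pt(E)` of the fibration of points along
`v : E ⟶ B`: it pulls the split epimorphism `p` back along `v`, with the induced section. -/
noncomputable def Pt.changeOfBase {C : Type u} [Category.{v} C] [HasPullbacks C] {E B : C}
    (v : E ⟶ B) : Pt B ⥤ Pt E where
  obj P := ⟨pullback P.p v, pullback.snd P.p v, Pt.pullbackSection v P, pullback.lift_snd _ _ _⟩
  map f := ⟨Pt.pullbackMap v f, pullback.lift_snd _ _ _, Pt.pullbackSection_comp_map v f⟩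
  map_id P := PtHom.ext (Pt.pullbackMap_id v P)
  map_comp f g := PtHom.ext (Pt.pullbackMap_comp v f g)

/-- A category with pullbacks is Bourn protomodular if all change-of-base functors of its
fibration of points reflect isomorphisms. -/
class BournProtomodular (C : Type u) [Category.{v} C] : Prop extends HasPullbacks C where
  reflectsIsomorphisms {E B : C} (v : E ⟶ B) : (Pt.changeOfBase v).ReflectsIsomorphisms

/-- A category is Barr exact if it is regular and every internal equivalence relation in it is
effective, i.e. is the kernel pair of its coequalizer. -/
class BarrExact (C : Type u) [Category.{v} C] : Prop extends Regular C where
  effective {R X : C} (p₁ p₂ : R ⟶ X) [IsEquivalenceRelation p₁ p₂] :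
    IsEffectiveEquivalenceRelation p₁ p₂

/-- A category is ideally exact if it is Barr exact and Bourn protomodular, it has finite
coproducts, and the morphism from its initial object to its terminal object is a regular
epimorphism. -/
class IsIdeallyExact (C : Type u) [Category.{v} C] : Prop extends
    BarrExact C, BournProtomodular C where
  [hasFiniteCoproducts : HasFiniteCoproducts C]
  isRegularEpi_initial_to_terminal : IsRegularEpi (terminal.from (⊥_ C))

end IdeallyExact

open CategoryTheory.MonoidalCategory CategoryTheory.CartesianMonoidalCategory
  CategoryTheory.HasSubobjectClassifier Opposite

namespace ElementaryTopos

noncomputable section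

/-! ### Heyting operations on predicates, via generalized elements. -/

section Forcing

variable {E : Type u} [Category.{v} E] [HasSubobjectClassifier E]

/-! The power object functor `power E : Eᵒᵖ ⥤ E` is faithful, self-adjoint, and by Beck–Chevalley
turns reflexive coequalizers into split ones (`powerSplitCoequalizer`), hence is monadic (Paré). So
`Eᵒᵖ` has finite limits, and exactness is checked after applying `power E`, where epimorphisms
split.

Protomodularity comes from a Heyting identity, `conj_imp_imp`: with `a = (x ⇒ y)` and `b = (((x ⇒ y)
⇒ y) ⇒ x)`, one has `x = (a ⇒ y) ∧ b`, and both `a` and `b` are true when `x = y`. Hence predicates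
on a split extension are determined by those true on the base, which a pushout controls
(`comp_bijective_of_isPushout`).

Finally, initial objects of `E` are strict, so `0 ⟶ 1` is monic in `E`; monomorphisms of `E` are
regular. -/

/-- The predicate on `W` that is constantly true. -/
abbrev verum (W : E) : W ⟶ Ω E := Subobject.Classifier.χ₀ _ W ≫ truth E

theorem comp_verum {V W : E} (g : V ⟶ W) : g ≫ verum W = verum V := by
  rw [verum, ← Category.assoc]
  congr 1
  exact Subsingleton.elim _ _

/-- A generalized element `g` of `X` satisfies the predicate `φ` on `X`. -/
def Forces {W X : E} (g : W ⟶ X) (φ : X ⟶ Ω E) : Prop := g ≫ φ = verum W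

theorem forces_comp {W X Y : E} (g : W ⟶ X) (f : X ⟶ Y) (φ : Y ⟶ Ω E) :
    Forces g (f ≫ φ) ↔ Forces (g ≫ f) φ := by
  simp [Forces]

theorem Forces.precomp {V W X : E} {g : W ⟶ X} {φ : X ⟶ Ω E} (h : Forces g φ) (k : V ⟶ W) :
    Forces (k ≫ g) φ := by
  rw [Forces, Category.assoc, h, comp_verum]

theorem forces_χ {W U X : E} (g : W ⟶ X) (m : U ⟶ X) [Mono m] :
    Forces g (χ m) ↔ ∃ h : W ⟶ U, h ≫ m = g := by
  constructor
  · intro h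
    exact ⟨(isPullback_χ m).lift g _ h, (isPullback_χ m).lift_fst _ _ _⟩
  · rintro ⟨h, rfl⟩
    rw [Forces, Category.assoc, HasSubobjectClassifier.comm]
    exact comp_verum h

/-- Equality on `X` is then pulled back from `X ⊗ Y`, so it cannot distinguish elements that `f`
identifies. -/
theorem mono_of_comp_surjective [CartesianMonoidalCategory E] {X Y : E} (f : X ⟶ Y)
    (hf : Function.Surjective fun φ : X ⊗ Y ⟶ Ω E => X ◁ f ≫ φ) : Mono f where
  right_cancellation {W} a b w := by
    have : Mono (lift (𝟙 X) (𝟙 X)) := mono_of_mono_fac (lift_fst (𝟙 X) (𝟙 X))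
    obtain ⟨φ, hφ⟩ := hf (χ (lift (𝟙 X) (𝟙 X)))
    dsimp only at hφ
    have h : Forces (lift a a) (X ◁ f ≫ φ) := by
      rw [hφ, forces_χ]
      exact ⟨a, by simp⟩
    have h' : Forces (lift a b) (X ◁ f ≫ φ) := by
      rw [forces_comp] at h ⊢
      simpa [w] using h
    rw [hφ, forces_χ] at h'
    obtain ⟨k, hk⟩ := h'
    have h₁ : k = a := by simpa using hk =≫ fst _ _
    have h₂ : k = b := by simpa using hk =≫ snd _ _
    exact h₁.symm.trans h₂

variable [HasFiniteLimits E]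

/-- The inclusion of the extension of a predicate. -/
abbrev extension {X : E} (φ : X ⟶ Ω E) : pullback φ (truth E) ⟶ X := pullback.fst φ (truth E)

theorem exists_comp_extension_iff {W X : E} (g : W ⟶ X) (φ : X ⟶ Ω E) :
    (∃ h, h ≫ extension φ = g) ↔ Forces g φ := by
  constructor
  · rintro ⟨h, rfl⟩
    rw [Forces, Category.assoc, pullback.condition, ← Category.assoc]
    congr 1
    exact Subsingleton.elim _ _
  · intro h
    exact ⟨pullback.lift g _ h, pullback.lift_fst _ _ _⟩

theorem isPullback_extension {X : E} (φ ψ : X ⟶ Ω E)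
    (h : ∀ {W : E} (g : W ⟶ X), Forces g φ ↔ Forces g ψ) :
    IsPullback (extension φ) (Subobject.Classifier.χ₀ _ _) ψ (truth E) := by
  have hφ : Forces (extension φ) ψ :=
    (h _).1 ((exists_comp_extension_iff _ φ).1 ⟨𝟙 _, Category.id_comp _⟩)
  refine ⟨⟨hφ⟩, ⟨PullbackCone.IsLimit.mk _ (fun s => pullback.lift s.fst s.snd ?_) ?_ ?_ ?_⟩⟩
  · have : Forces s.fst ψ := by
      rw [Forces, s.condition]
      congr 1
      exact Subsingleton.elim _ _
    rw [(h _).2 this, verum]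
    congr 1
    exact Subsingleton.elim _ _
  · exact fun s => pullback.lift_fst _ _ _
  · intro s
    exact Subsingleton.elim _ _
  · intro s m hm _
    rw [← cancel_mono (extension φ), hm, pullback.lift_fst]

/-- Predicates are determined by the generalized elements satisfying them. -/
theorem predicate_ext {X : E} {φ ψ : X ⟶ Ω E}
    (h : ∀ {W : E} (g : W ⟶ X), Forces g φ ↔ Forces g ψ) : φ = ψ :=
  (unique _ _ (isPullback_extension φ φ fun _ => Iff.rfl)).trans
    (unique _ _ (isPullback_extension φ ψ h)).symm

/-- The conjunction of two predicates. -/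
def conj {X : E} (φ ψ : X ⟶ Ω E) : X ⟶ Ω E :=
  χ (pullback.fst (extension φ) (extension ψ) ≫ extension φ)

theorem forces_conj {W X : E} (g : W ⟶ X) (φ ψ : X ⟶ Ω E) :
    Forces g (conj φ ψ) ↔ Forces g φ ∧ Forces g ψ := by
  rw [conj, forces_χ, ← exists_comp_extension_iff g φ, ← exists_comp_extension_iff g ψ]
  constructor
  · rintro ⟨h, rfl⟩
    exact ⟨⟨h ≫ pullback.fst _ _, Category.assoc _ _ _⟩,
      ⟨h ≫ pullback.snd _ _, by rw [Category.assoc, pullback.condition]⟩⟩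
  · rintro ⟨⟨h, rfl⟩, k, hk⟩
    exact ⟨pullback.lift h k hk.symm, by rw [pullback.lift_fst_assoc]⟩

/-- The implication between two predicates. -/
def imp {X : E} (φ ψ : X ⟶ Ω E) : X ⟶ Ω E := χ (equalizer.ι (conj φ ψ) φ)

theorem forces_imp {W X : E} (g : W ⟶ X) (φ ψ : X ⟶ Ω E) :
    Forces g (imp φ ψ) ↔ ∀ {V : E} (k : V ⟶ W), Forces (k ≫ g) φ → Forces (k ≫ g) ψ := by
  rw [imp, forces_χ]
  constructor
  · rintro ⟨h, rfl⟩ V k hk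
    rw [← Category.assoc, ← forces_comp, ← equalizer.condition, forces_comp, forces_conj] at hk
    simpa using hk.2
  · intro H
    refine ⟨equalizer.lift g (predicate_ext fun k => ?_), equalizer.lift_ι _ _⟩
    rw [forces_comp, forces_comp, forces_conj]
    exact ⟨And.left, fun hk => ⟨hk, H k hk⟩⟩

theorem comp_conj {X Y : E} (f : X ⟶ Y) (φ ψ : Y ⟶ Ω E) :
    f ≫ conj φ ψ = conj (f ≫ φ) (f ≫ ψ) :=
  predicate_ext fun g => by simp only [forces_comp, forces_conj]

theorem comp_imp {X Y : E} (f : X ⟶ Y) (φ ψ : Y ⟶ Ω E) :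
    f ≫ imp φ ψ = imp (f ≫ φ) (f ≫ ψ) :=
  predicate_ext fun g => by simp only [forces_comp, forces_imp, Category.assoc]

theorem imp_self {X : E} (φ : X ⟶ Ω E) : imp φ φ = verum X :=
  predicate_ext fun g => by
    rw [forces_imp]
    exact iff_of_true (fun k hk => hk) (comp_verum g)

theorem verum_imp {X : E} (φ : X ⟶ Ω E) : imp (verum X) φ = φ :=
  predicate_ext fun g => by
    rw [forces_imp]
    exact ⟨fun h => by simpa using h (𝟙 _) (comp_verum _), fun h _ k _ => h.precomp k⟩

/-- A predicate is recovered from its implications with any other predicate. -/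
theorem conj_imp_imp {X : E} (φ ψ : X ⟶ Ω E) :
    conj (imp (imp φ ψ) ψ) (imp (imp (imp φ ψ) ψ) φ) = φ :=
  predicate_ext fun g => by
    rw [forces_conj]
    constructor
    · rintro ⟨h₁, h₂⟩
      rw [forces_imp] at h₂
      simpa using h₂ (𝟙 _) (by simpa using h₁)
    · intro h
      refine ⟨(forces_imp _ _ _).2 fun k hk => ?_, (forces_imp _ _ _).2 fun k _ => h.precomp k⟩
      rw [forces_imp] at hk
      simpa using hk (𝟙 _) (by simpa using h.precomp k)

/-- The image of a predicate along a monomorphism. -/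
def existsAlong {X Y : E} (m : X ⟶ Y) [Mono m] (φ : X ⟶ Ω E) : Y ⟶ Ω E := χ (extension φ ≫ m)

theorem forces_existsAlong {W X Y : E} (g : W ⟶ Y) (m : X ⟶ Y) [Mono m] (φ : X ⟶ Ω E) :
    Forces g (existsAlong m φ) ↔ ∃ h : W ⟶ X, h ≫ m = g ∧ Forces h φ := by
  rw [existsAlong, forces_χ]
  constructor
  · rintro ⟨h, rfl⟩
    exact ⟨h ≫ extension φ, Category.assoc _ _ _, (exists_comp_extension_iff _ _).1 ⟨h, rfl⟩⟩
  · rintro ⟨h, rfl, hφ⟩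
    obtain ⟨k, rfl⟩ := (exists_comp_extension_iff _ _).2 hφ
    exact ⟨k, (Category.assoc _ _ _).symm⟩

/-- The Beck–Chevalley condition for images along monomorphisms. -/
theorem comp_existsAlong {X' X Y' Y : E} {a : X' ⟶ X} {m' : X' ⟶ Y'} {m : X ⟶ Y} {b : Y' ⟶ Y}
    [Mono m] [Mono m'] (sq : IsPullback a m' m b) (φ : X ⟶ Ω E) :
    b ≫ existsAlong m φ = existsAlong m' (a ≫ φ) :=
  predicate_ext fun g => by
    rw [forces_comp, forces_existsAlong, forces_existsAlong]
    constructor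
    · rintro ⟨h, e, hφ⟩
      exact ⟨sq.lift h g e, sq.lift_snd _ _ _, by rwa [forces_comp, sq.lift_fst]⟩
    · rintro ⟨h, rfl, hφ⟩
      exact ⟨h ≫ a, by rw [Category.assoc, sq.w, Category.assoc], by rwa [← forces_comp]⟩

theorem comp_existsAlong_self {X Y : E} (m : X ⟶ Y) [Mono m] (φ : X ⟶ Ω E) :
    m ≫ existsAlong m φ = φ := by
  rw [comp_existsAlong (IsKernelPair.id_of_mono m)]
  refine predicate_ext fun g => ?_
  rw [forces_existsAlong]
  simp

/-- The predicate `a = b` on `Y` becomes true along `f`, so it is already true. -/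
theorem epi_of_comp_injective {X Y : E} (f : X ⟶ Y)
    (hf : Function.Injective fun φ : Y ⟶ Ω E => f ≫ φ) : Epi f where
  left_cancellation a b w := by
    have h : Forces f (χ (equalizer.ι a b)) := (forces_χ _ _).2 ⟨equalizer.lift f w, by simp⟩
    have h' : Forces (𝟙 Y) (χ (equalizer.ι a b)) := by
      rw [Forces, Category.id_comp]
      exact hf (h.trans (comp_verum f).symm)
    obtain ⟨k, hk⟩ := (forces_χ _ _).1 h'
    rw [← Category.id_comp a, ← Category.id_comp b, ← hk, Category.assoc, Category.assoc,
      equalizer.condition]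

/-- A morphism of split extensions along which two pushouts agree induces a bijection on
predicates. -/
theorem comp_bijective_of_isPushout {B X Y A D D' : E} {p : B ⟶ X} {s : X ⟶ B} {q : B ⟶ Y}
    {t : Y ⟶ B} (hq : q ≫ t = 𝟙 B) (f : X ⟶ Y) (hpf : p ≫ f = q)
    (hft : f ≫ t = s) {v : B ⟶ A} {i : X ⟶ D} {j : A ⟶ D} {i' : Y ⟶ D'} {j' : A ⟶ D'}
    (sq : IsPushout p v i j) (sq' : IsPushout q v i' j') (d : D ⟶ D') [IsIso d]
    (hi : i ≫ d = f ≫ i') (hj : j ≫ d = j') :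
    Function.Bijective fun φ : Y ⟶ Ω E => f ≫ φ := by
  -- A predicate that is true on `B` extends to the pushout by truth on `A`; the isomorphism `d`
  -- compares these extensions.
  have inj (k k' : Y ⟶ Ω E) (hk : q ≫ k = verum B) (hk' : q ≫ k' = verum B)
      (h : f ≫ k = f ≫ k') : k = k' := by
    have hv : v ≫ verum A = verum B := comp_verum v
    have : sq'.desc k (verum A) (hk.trans hv.symm) = sq'.desc k' (verum A) (hk'.trans hv.symm) := by
      rw [← cancel_epi d]
      apply sq.hom_ext
      · rw [reassoc_of% hi, reassoc_of% hi, sq'.inl_desc, sq'.inl_desc, h]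
      · rw [reassoc_of% hj, reassoc_of% hj, sq'.inr_desc, sq'.inr_desc]
    rw [← sq'.inl_desc k (verum A) (hk.trans hv.symm), this, sq'.inl_desc]
  have surj (k : X ⟶ Ω E) (hk : p ≫ k = verum B) : ∃ l : Y ⟶ Ω E, q ≫ l = verum B ∧ f ≫ l = k := by
    have hv : v ≫ verum A = verum B := comp_verum v
    refine ⟨i' ≫ inv d ≫ sq.desc k (verum A) (hk.trans hv.symm), ?_, ?_⟩
    · rw [reassoc_of% sq'.w, ← hj, Category.assoc, IsIso.hom_inv_id_assoc, sq.inr_desc, hv]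
    · rw [← reassoc_of% hi, IsIso.hom_inv_id_assoc, sq.inl_desc]
  have hps : p ≫ s = 𝟙 B := by rw [← hft, reassoc_of% hpf, hq]
  constructor
  · intro φ ψ (h : f ≫ φ = f ≫ ψ)
    have hqe : q ≫ φ = q ≫ ψ := by rw [← hpf, Category.assoc, h, Category.assoc]
    -- Here `y` is `φ` restricted to `B` and transported back along `t`; it agrees with `φ` on `B`,
    -- so both implications are true there.
    have h₁ : imp φ (t ≫ q ≫ φ) = imp ψ (t ≫ q ≫ ψ) := by
      apply inj
      · rw [comp_imp, reassoc_of% hq, imp_self]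
      · rw [comp_imp, reassoc_of% hq, imp_self]
      · rw [comp_imp, comp_imp, h, hqe]
    have h₂ : imp (imp (imp φ (t ≫ q ≫ φ)) (t ≫ q ≫ φ)) φ =
        imp (imp (imp ψ (t ≫ q ≫ ψ)) (t ≫ q ≫ ψ)) ψ := by
      apply inj
      · simp only [comp_imp, reassoc_of% hq, imp_self, verum_imp]
      · simp only [comp_imp, reassoc_of% hq, imp_self, verum_imp]
      · simp only [comp_imp, h, hqe]
    rw [← conj_imp_imp φ (t ≫ q ≫ φ), h₂, h₁, hqe, conj_imp_imp]
  · intro φ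
    obtain ⟨k, -, hk⟩ := surj (imp φ (s ≫ p ≫ φ))
      (by rw [comp_imp, reassoc_of% hps, imp_self])
    obtain ⟨l, -, hl⟩ := surj (imp (imp (imp φ (s ≫ p ≫ φ)) (s ≫ p ≫ φ)) φ)
      (by simp only [comp_imp, reassoc_of% hps, imp_self, verum_imp])
    refine ⟨conj (imp k (t ≫ p ≫ φ)) l, ?_⟩
    dsimp only
    rw [comp_conj, comp_imp, hk, hl, reassoc_of% hft, conj_imp_imp]

end Forcing

/-! ### Products with a parameter object, and strictness of the initial object. -/

section Cartesian

variable {E : Type u} [Category.{v} E] [CartesianMonoidalCategory E]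

instance {X Y : E} (m : X ⟶ Y) [Mono m] (T : E) : Mono (m ▷ T) where
  right_cancellation a b h := by
    apply CartesianMonoidalCategory.hom_ext
    · rw [← cancel_mono m]
      simpa using h =≫ fst _ _
    · simpa using h =≫ snd _ _

theorem isPullback_whiskerRight {P X Y Z : E} {a : P ⟶ X} {b : P ⟶ Y} {f : X ⟶ Z} {g : Y ⟶ Z}
    (sq : IsPullback a b f g) (T : E) : IsPullback (a ▷ T) (b ▷ T) (f ▷ T) (g ▷ T) := by
  refine ⟨⟨by rw [← comp_whiskerRight, sq.w, comp_whiskerRight]⟩,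
    ⟨PullbackCone.IsLimit.mk _ (fun s => lift (sq.lift (s.fst ≫ fst _ _) (s.snd ≫ fst _ _) ?_)
      (s.fst ≫ snd _ _)) ?_ ?_ ?_⟩⟩
  · simpa using s.condition =≫ fst _ _
  · intro s
    apply CartesianMonoidalCategory.hom_ext <;> simp
  · intro s
    have h := s.condition =≫ snd _ _
    apply CartesianMonoidalCategory.hom_ext <;> simp_all
  · intro s m h₁ h₂
    apply CartesianMonoidalCategory.hom_ext
    · apply sq.hom_ext
      · simp [← h₁]
      · simp [← h₂]
    · simp [← h₁]

theorem isPullback_whisker_exchange {X Y S T : E} (f : X ⟶ Y) (g : S ⟶ T) :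
    IsPullback (X ◁ g) (f ▷ S) (f ▷ T) (Y ◁ g) := by
  refine ⟨⟨whisker_exchange f g⟩,
    ⟨PullbackCone.IsLimit.mk _ (fun s => lift (s.fst ≫ fst _ _) (s.snd ≫ snd _ _)) ?_ ?_ ?_⟩⟩
  · intro s
    have h := s.condition =≫ snd _ _
    apply CartesianMonoidalCategory.hom_ext <;> simp_all
  · intro s
    have h := s.condition =≫ fst _ _
    apply CartesianMonoidalCategory.hom_ext <;> simp_all
  · intro s m h₁ h₂
    apply CartesianMonoidalCategory.hom_ext
    · simp [← h₁]
    · simp [← h₂]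

theorem epi_of_isTerminal_op {I T : Eᵒᵖ} [MonoidalClosed E] (hT : IsTerminal T) (f : I ⟶ T) :
    Epi f := by
  have : Mono f.unop := by
    rw [(initialUnopOfTerminal hT).hom_ext f.unop ((initialUnopOfTerminal hT).to _)]
    exact initial_mono _ _
  exact op_epi_of_mono f.unop

end Cartesian

/-! ### Reflexive pairs and split coequalizers. -/

section Relations

variable {C : Type u} [Category.{v} C]

/-- The common section forces the two legs of any cocone to coincide. -/
theorem isPushout_of_isReflexivePair {R X : C} {p₁ p₂ : R ⟶ X} [IsReflexivePair p₁ p₂]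
    {c : Cofork p₁ p₂} (hc : IsColimit c) : IsPushout p₁ p₂ c.π c.π := by
  have eq {Z : C} {a b : X ⟶ Z} (h : p₁ ≫ a = p₂ ≫ b) : a = b := by
    have := commonSection p₁ p₂ ≫= h
    simpa using this
  refine ⟨⟨c.condition⟩, ⟨PushoutCocone.IsColimit.mk _
    (fun s => Cofork.IsColimit.desc hc s.inl ?_) ?_ ?_ ?_⟩⟩
  · rw [s.condition, eq s.condition]
  · exact fun s => Cofork.IsColimit.π_desc' hc _ _
  · exact fun s => (Cofork.IsColimit.π_desc' hc _ _).trans (eq s.condition)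
  · intro s m h _
    apply Cofork.IsColimit.hom_ext hc
    rw [h]
    exact (Cofork.IsColimit.π_desc' hc _ _).symm

/-- A symmetric transitive relation with a split coequalizer contains the kernel pair of that
coequalizer. -/
theorem exists_lift_of_isSplitCoequalizer {R X Q T : C} {p₁ p₂ : R ⟶ X} {π : X ⟶ Q}
    (hπ : IsSplitCoequalizer p₁ p₂ π) (s : R ⟶ R) (hs₁ : s ≫ p₁ = p₂) (hs₂ : s ≫ p₂ = p₁)
    {c₁ c₂ : T ⟶ R} (sq : IsPullback c₁ c₂ p₂ p₁) (t : T ⟶ R) (ht₁ : t ≫ p₁ = c₁ ≫ p₁)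
    (ht₂ : t ≫ p₂ = c₂ ≫ p₂) {W : C} (a b : W ⟶ X) (h : a ≫ π = b ≫ π) :
    ∃ l : W ⟶ R, l ≫ p₁ = a ∧ l ≫ p₂ = b := by
  -- With `σ` the right section, `leftSection` relates `σ(π x)` to `x`; compose `a ~ σ(π a) = σ(π b)
  -- ~ b`.
  refine ⟨sq.lift (a ≫ hπ.leftSection ≫ s) (b ≫ hπ.leftSection) ?_ ≫ t, ?_, ?_⟩
  · simp [hs₂, reassoc_of% h]
  · simp [ht₁, hs₁]
  · simp [ht₂]

end Relations

/-! ### Monadicity of the power object functor. -/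

section Power

variable {E : Type u} [Category.{v} E] [CartesianMonoidalCategory E] [MonoidalClosed E]
  [HasSubobjectClassifier E]

variable (E) in
/-- The contravariant power object functor. -/
def power : Eᵒᵖ ⥤ E := MonoidalClosed.internalHom.flip.obj (Ω E)

/-- Morphisms into a power object correspond to predicates on a product. -/
def powerEquiv {X : Eᵒᵖ} {T : E} : (X.unop ⊗ T ⟶ Ω E) ≃ (T ⟶ (power E).obj X) :=
  ((ihom.adjunction X.unop).homEquiv T (Ω E))

theorem comp_powerEquiv {X : Eᵒᵖ} {S T : E} (g : S ⟶ T) (φ : X.unop ⊗ T ⟶ Ω E) :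
    g ≫ powerEquiv φ = powerEquiv (X.unop ◁ g ≫ φ) :=
  (MonoidalClosed.curry_natural_left g φ).symm

theorem powerEquiv_comp_map {X Y : Eᵒᵖ} (f : X ⟶ Y) {T : E} (φ : X.unop ⊗ T ⟶ Ω E) :
    powerEquiv φ ≫ (power E).map f = powerEquiv (f.unop ▷ T ≫ φ) :=
  MonoidalClosed.curry_pre_app _ _

theorem powerEquiv_symm_comp {X : Eᵒᵖ} {S T : E} (g : S ⟶ T) (h : T ⟶ (power E).obj X) :
    powerEquiv.symm (g ≫ h) = X.unop ◁ g ≫ powerEquiv.symm h := by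
  rw [Equiv.symm_apply_eq, ← comp_powerEquiv, Equiv.apply_symm_apply]

/-- The characteristic map of the graph of `f`, pulled back along `g`, holds on the diagonal only if
`f = g`. -/
instance : (power E).Faithful where
  map_injective {X Y} f g h := by
    let d : Y.unop ⟶ X.unop ⊗ Y.unop := lift f.unop (𝟙 _)
    have : Mono d := mono_of_mono_fac (lift_snd f.unop (𝟙 _))
    have key : f.unop ▷ Y.unop ≫ χ d = g.unop ▷ Y.unop ≫ χ d := by
      apply powerEquiv.injective
      rw [← powerEquiv_comp_map, ← powerEquiv_comp_map, h]
    have hf : Forces (lift (𝟙 _) (𝟙 Y.unop)) (f.unop ▷ Y.unop ≫ χ d) :=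
      (forces_comp _ _ _).2 ((forces_χ _ _).2 ⟨𝟙 _, by simp [d]⟩)
    rw [key, forces_comp, forces_χ] at hf
    obtain ⟨k, hk⟩ := hf
    have h₁ : k = 𝟙 _ := by simpa [d] using hk =≫ snd _ _
    have h₂ : k ≫ f.unop = g.unop := by simpa [d] using hk =≫ fst _ _
    apply Quiver.Hom.unop_inj
    rw [← h₂, h₁, Category.id_comp]

section Image

variable [HasFiniteLimits E]

/-- The direct image morphism between power objects along a monomorphism. -/
def powerImage {X Y : E} (m : X ⟶ Y) [Mono m] :
    (power E).obj (op X) ⟶ (power E).obj (op Y) :=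
  powerEquiv (X := op Y) (existsAlong (m ▷ _) ((powerEquiv (X := op X)).symm (𝟙 _)))

theorem powerEquiv_comp_powerImage {X Y T : E} (m : X ⟶ Y) [Mono m] (φ : X ⊗ T ⟶ Ω E) :
    powerEquiv (X := op X) φ ≫ powerImage m = powerEquiv (X := op Y) (existsAlong (m ▷ T) φ) := by
  rw [powerImage, comp_powerEquiv, comp_existsAlong (isPullback_whisker_exchange m _),
    ← powerEquiv_symm_comp (X := op X), Category.comp_id, Equiv.symm_apply_apply]

theorem powerImage_comp_map {X Y : E} (m : X ⟶ Y) [Mono m] :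
    powerImage m ≫ (power E).map m.op = 𝟙 _ := by
  rw [powerImage, powerEquiv_comp_map, Quiver.Hom.unop_op, comp_existsAlong_self,
    Equiv.apply_symm_apply]

/-- The Beck–Chevalley condition for power objects. -/
theorem powerImage_comp_map_of_isPullback {P X Y Z : E} {a : P ⟶ X} {b : P ⟶ Y} {f : X ⟶ Z}
    {g : Y ⟶ Z} [Mono f] [Mono b] (sq : IsPullback a b f g) :
    powerImage f ≫ (power E).map g.op = (power E).map a.op ≫ powerImage b := by
  conv_rhs => rw [← Category.id_comp ((power E).map a.op),
    ← powerEquiv.apply_symm_apply (𝟙 ((power E).obj (op X)))]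
  rw [powerImage, powerEquiv_comp_map, Quiver.Hom.unop_op,
    comp_existsAlong (isPullback_whiskerRight sq _), powerEquiv_comp_map,
    powerEquiv_comp_powerImage, Quiver.Hom.unop_op]

/-- The power object functor sends the coequalizer of a reflexive pair to a split coequalizer. -/
def powerSplitCoequalizer {R X Q : Eᵒᵖ} {p₁ p₂ : R ⟶ X} {π : X ⟶ Q} [IsSplitEpi p₂]
    (sq : IsPushout p₁ p₂ π π) :
    IsSplitCoequalizer ((power E).map p₁) ((power E).map p₂) ((power E).map π) :=
  haveI : Epi π := ⟨fun _ _ h => sq.hom_ext h h⟩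
  -- Both sections are direct images; the mixed identity is Beck–Chevalley for the pullback square
  -- in `E`.
  { rightSection := powerImage π.unop
    leftSection := powerImage p₂.unop
    condition := by rw [← Functor.map_comp, sq.w, Functor.map_comp]
    rightSection_π := powerImage_comp_map π.unop
    leftSection_bottom := powerImage_comp_map p₂.unop
    leftSection_top := powerImage_comp_map_of_isPullback sq.unop }

end Image

variable [BraidedCategory E]

instance (J : Type*) [Category* J] : PreservesLimitsOfShape J (power E) :=
  inferInstanceAs (PreservesLimitsOfShape J (MonoidalClosed.internalHom.flip.obj (Ω E)))

variable (E) in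
/-- The power object functor is self-adjoint on the right. -/
def powerAdjunction : (power E).rightOp ⊣ power E :=
  Adjunction.mkOfHomEquiv
    { homEquiv := fun A Y =>
        { toFun := fun f =>
            powerEquiv ((β_ Y.unop A).hom ≫ (powerEquiv (X := op A)).symm f.unop)
          invFun := fun g =>
            Quiver.Hom.op (powerEquiv (X := op A) ((β_ A Y.unop).hom ≫ powerEquiv.symm g))
          left_inv := fun f => Quiver.Hom.unop_inj (by
            dsimp only [Quiver.Hom.unop_op]
            rw [Equiv.symm_apply_apply, SymmetricCategory.symmetry_assoc, Equiv.apply_symm_apply])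
          right_inv := fun g => by
            dsimp only [Quiver.Hom.unop_op]
            rw [Equiv.symm_apply_apply, SymmetricCategory.symmetry_assoc, Equiv.apply_symm_apply] }
      homEquiv_naturality_left_symm := fun {A A' Y} f g => Quiver.Hom.unop_inj (by
        change powerEquiv (X := op A) ((β_ A Y.unop).hom ≫ powerEquiv.symm (f ≫ g)) =
          powerEquiv (X := op A') ((β_ A' Y.unop).hom ≫ powerEquiv.symm g) ≫ (power E).map f.op
        rw [powerEquiv_comp_map, powerEquiv_symm_comp, Quiver.Hom.unop_op,
          BraidedCategory.braiding_naturality_left_assoc])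
      homEquiv_naturality_right := fun {A Y Y'} f g => by
        change powerEquiv ((β_ Y'.unop A).hom ≫
            (powerEquiv (X := op A)).symm (g.unop ≫ f.unop)) =
          powerEquiv ((β_ Y.unop A).hom ≫ (powerEquiv (X := op A)).symm f.unop) ≫ (power E).map g
        rw [powerEquiv_comp_map, powerEquiv_symm_comp,
          BraidedCategory.braiding_naturality_left_assoc] }

variable [HasFiniteLimits E]

instance : PreservesFiniteLimits (power E) := ⟨fun _ => inferInstance⟩

instance : Monad.PreservesColimitOfIsReflexivePair (power E) where
  out {A B} f g _ := by
    have sq := isPushout_of_isReflexivePair (coequalizerIsCoequalizer f g)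
    have : IsSplitEpi g := ⟨⟨⟨commonSection f g, section_comp_right f g⟩⟩⟩
    exact preservesColimit_of_preserves_colimit_cocone (coequalizerIsCoequalizer f g)
      ((isColimitMapCoconeCoforkEquiv (power E) (coequalizer.condition f g)).symm
        (powerSplitCoequalizer sq).isCoequalizer)

/-- Crude monadicity theorem. -/
instance : MonadicRightAdjoint (power E) :=
  Monad.monadicOfHasPreservesReflexiveCoequalizersOfReflectsIsomorphisms (powerAdjunction E)

instance : HasFiniteLimits Eᵒᵖ where
  out _ _ _ :=
    letI := monadicCreatesLimits (power E)
    hasLimitsOfShape_of_hasLimitsOfShape_createsLimitsOfShape (power E)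

end Power
-- Exactness and protomodularity of the opposite category.
section Opposite

variable {E : Type u} [Category.{v} E] [HasFiniteLimits E] [HasSubobjectClassifier E]

instance : IsRegularEpiCategory Eᵒᵖ where
  regularEpiOfEpi f _ := by
    rw [← isRegularMono_unop_iff_isRegularEpi]
    have := regularMonoOfMono f.unop
    exact ⟨⟨this⟩⟩

variable [CartesianMonoidalCategory E] [MonoidalClosed E]

/-- Morphisms of split extensions are isomorphisms if their pushouts are. -/
theorem isIso_of_isPushout {B X Y A D D' : E} {p : B ⟶ X} {s : X ⟶ B} {q : B ⟶ Y}
    {t : Y ⟶ B} (hq : q ≫ t = 𝟙 B) (f : X ⟶ Y) (hpf : p ≫ f = q)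
    (hft : f ≫ t = s) {v : B ⟶ A} {i : X ⟶ D} {j : A ⟶ D} {i' : Y ⟶ D'} {j' : A ⟶ D'}
    (sq : IsPushout p v i j) (sq' : IsPushout q v i' j') (d : D ⟶ D') [IsIso d]
    (hi : i ≫ d = f ≫ i') (hj : j ≫ d = j') : IsIso f := by
  have : Epi f := epi_of_comp_injective f
    (comp_bijective_of_isPushout hq f hpf hft sq sq' d hi hj).injective
  -- Cartesian closedness makes `X ⊗ -` preserve pushouts, so the bijection also holds with a
  -- parameter in `X`.
  have bij := comp_bijective_of_isPushout (p := X ◁ p) (s := X ◁ s) (q := X ◁ q) (t := X ◁ t)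
    (by rw [← whiskerLeft_comp, hq, whiskerLeft_id]) (X ◁ f)
    (by rw [← whiskerLeft_comp, hpf]) (by rw [← whiskerLeft_comp, hft])
    (sq.map (tensorLeft X)) (sq'.map (tensorLeft X)) (X ◁ d)
    (by simp [← whiskerLeft_comp, hi]) (by simp [← whiskerLeft_comp, hj])
  have : Mono f := mono_of_comp_surjective f bij.surjective
  exact isIso_of_mono_of_epi f

variable [BraidedCategory E]

/-- Direct images split the images of epimorphisms under `power E`; split epimorphisms are
pullback-stable, and a faithful functor reflects epimorphisms. -/
instance : (MorphismProperty.regularEpi Eᵒᵖ).IsStableUnderBaseChange where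
  of_isPullback {X Y Y' S f g f' g'} sq hg := by
    have : IsRegularEpi g := hg
    have : IsSplitEpi ((power E).map g) := ⟨⟨⟨powerImage g.unop, powerImage_comp_map g.unop⟩⟩⟩
    have : IsSplitEpi ((power E).map g') := by
      have sqP := sq.map (power E)
      exact ⟨⟨⟨sqP.lift ((power E).map f ≫ powerImage g.unop) (𝟙 _)
        (by rw [Category.assoc, Category.id_comp]
            exact (congrArg _ (powerImage_comp_map g.unop)).trans (Category.comp_id _)),
        sqP.lift_snd _ _ _⟩⟩⟩
    have : Epi g' := (power E).epi_of_epi_map inferInstance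
    exact IsRegularEpiCategory.regularEpiOfEpi g'

instance : Regular Eᵒᵖ where
  hasCoequalizer_of_isKernelPair _ := inferInstance
  regularEpiIsStableUnderBaseChange := inferInstance

/-- The monic comparison `k` to the kernel pair of `π` becomes split epic under `power E`, since the
coequalizer splits there; `power E` preserves monomorphisms and reflects isomorphisms. -/
theorem isKernelPair_op {R X Q : Eᵒᵖ} {p₁ p₂ : R ⟶ X} {π : X ⟶ Q} (e : EquivalenceRelation p₁ p₂)
    (sq : IsPushout p₁ p₂ π π) : IsKernelPair π p₁ p₂ := by
  have : IsSplitEpi p₂ := ⟨⟨⟨e.r, e.reflexivity₂⟩⟩⟩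
  have sqT : IsPullback e.c.fst e.c.snd p₂ p₁ := ⟨⟨e.c.condition⟩, ⟨e.isLimit.ofIsoLimit e.c.eta⟩⟩
  let k : R ⟶ pullback π π := pullback.lift p₁ p₂ sq.w
  have h₁ : k ≫ pullback.fst π π = p₁ := pullback.lift_fst _ _ _
  have h₂ : k ≫ pullback.snd π π = p₂ := pullback.lift_snd _ _ _
  have : Mono k := ⟨fun a b h => e.right_cancellation a b
    (by rw [← h₁, reassoc_of% h]) (by rw [← h₂, reassoc_of% h])⟩
  have sqK := (IsPullback.of_hasPullback π π).map (power E)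
  obtain ⟨l, hl₁, hl₂⟩ := exists_lift_of_isSplitCoequalizer (powerSplitCoequalizer sq)
    ((power E).map e.s) (by rw [← Functor.map_comp, e.symmetry₁])
    (by rw [← Functor.map_comp, e.symmetry₂]) (sqT.map (power E)) ((power E).map e.t)
    (by rw [← Functor.map_comp, e.transitivity₁, Functor.map_comp])
    (by rw [← Functor.map_comp, e.transitivity₂, Functor.map_comp]) _ _ sqK.w
  have : IsSplitEpi ((power E).map k) := ⟨⟨⟨l, sqK.hom_ext
    (by rw [Category.assoc, ← Functor.map_comp, h₁, hl₁, Category.id_comp])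
    (by rw [Category.assoc, ← Functor.map_comp, h₂, hl₂, Category.id_comp])⟩⟩⟩
  have : IsIso ((power E).map k) := isIso_of_mono_of_isSplitEpi _
  have : IsIso k := isIso_of_reflects_iso k (power E)
  exact .of_iso_pullback ⟨sq.w⟩ (asIso k) h₁ h₂

instance : IdeallyExact.BarrExact Eᵒᵖ where
  effective {R X} p₁ p₂ h := by
    obtain ⟨⟨e⟩⟩ := h
    have : IsReflexivePair p₁ p₂ := ⟨e.r, e.reflexivity₁, e.reflexivity₂⟩
    have sq := isPushout_of_isReflexivePair (coequalizerIsCoequalizer p₁ p₂)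
    exact ⟨⟨{ e with B := _, π := _, isKernelPair := isKernelPair_op e sq, isPushout := sq }⟩⟩

instance : IdeallyExact.BournProtomodular Eᵒᵖ where
  reflectsIsomorphisms {A B} v := by
    refine ⟨fun {P Q} f hf => ?_⟩
    have hd : IsIso (IdeallyExact.Pt.pullbackMap v f) :=
      ⟨(inv ((IdeallyExact.Pt.changeOfBase v).map f)).hom,
        congrArg IdeallyExact.PtHom.hom
          (IsIso.hom_inv_id ((IdeallyExact.Pt.changeOfBase v).map f)),
        congrArg IdeallyExact.PtHom.hom
          (IsIso.inv_hom_id ((IdeallyExact.Pt.changeOfBase v).map f))⟩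
    have h₁ : IdeallyExact.Pt.pullbackMap v f ≫ pullback.fst Q.p v = pullback.fst P.p v ≫ f.hom :=
      pullback.lift_fst _ _ _
    have h₂ : IdeallyExact.Pt.pullbackMap v f ≫ pullback.snd Q.p v = pullback.snd P.p v :=
      pullback.lift_snd _ _ _
    have hu : IsIso f.hom.unop := by
      refine isIso_of_isPushout (congrArg Quiver.Hom.unop P.w) f.hom.unop
        (congrArg Quiver.Hom.unop f.comm_p) (congrArg Quiver.Hom.unop f.comm_s)
        (IsPullback.of_hasPullback Q.p v).unop.flip (IsPullback.of_hasPullback P.p v).unop.flip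
        (IdeallyExact.Pt.pullbackMap v f).unop ?_ ?_
      · exact congrArg Quiver.Hom.unop h₁
      · exact congrArg Quiver.Hom.unop h₂
    have : IsIso f.hom := (isIso_unop_iff f.hom).1 hu
    refine ⟨⟨inv f.hom, ?_, ?_⟩, ?_, ?_⟩
    · rw [IsIso.inv_comp_eq, f.comm_p]
    · rw [IsIso.comp_inv_eq, f.comm_s]
    · exact IdeallyExact.PtHom.ext (IsIso.hom_inv_id f.hom)
    · exact IdeallyExact.PtHom.ext (IsIso.inv_hom_id f.hom)

end Opposite

end

end ElementaryTopos

theorem mainTheorem9 (E : Type u) [Category.{v} E] [HasFiniteLimits E]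
    [CartesianMonoidalCategory E] [MonoidalClosed E] [HasSubobjectClassifier E] :
    IdeallyExact.IsIdeallyExact Eᵒᵖ := by
  let := BraidedCategory.ofCartesianMonoidalCategory (C := E)
  have : Epi (terminal.from (⊥_ Eᵒᵖ)) := ElementaryTopos.epi_of_isTerminal_op terminalIsTerminal _
  exact { isRegularEpi_initial_to_terminal := IsRegularEpiCategory.regularEpiOfEpi _ }
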